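/- Fix an integer $d\ge 0$ and a real number $p$ with $1<p<\infty$. For $z\in\mathbb{C}^d$ write $z^2=z_1^2+\cdots+z_d^2$ (no complex conjugation), and let $\rho(z)=(2\pi)^{-d/2}e^{-z^2/2}$, so that $\rho(x)\,dx$ is the standard Gaussian measure on $\mathbb{R}^d$. Let $L^p(\mathbb{R}^d,\rho)$ denote the space of (almost-everywhere classes of) complex-valued functions that are $p$-integrable with respect to $\rho(x)\,dx$. For $f\in L^p(\mathbb{R}^d,\rho)$ the Segal–Bargmann transform of $f$ is $$Sf(z)=\int_{\mathbb{R}^d}\rho(z-x)\,f(x)\,dx=(2\pi)^{-d/2}\int_{\mathbb{R}^d}e^{-(z-x)^2/2}f(x)\,dx,\qquad z\in\mathbb{C}^d .$$ Suppose that $F:\mathbb{C}^d\to\mathbb{C}$ is an entire holomorphic function such that $$\int_{\mathbb{R}^d}\int_{\mathbb{R}^d}|F(x+iy)|\,e^{-y^2/2}\,e^{-x^2/(2(p-1))}\,dx\,dy<\infty .$$ Then there exists a unique $f\in L^p(\mathbb{R}^d,\rho)$ with $Sf(z)=F(z)$ for all $z\in\mathbb{C}^d$. -/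

import Mathlib

noncomputable section

namespace SegalBargmann

open MeasureTheory

/-- The standard Gaussian density `ρ(x) = (2π)^(-d/2) exp(-x²/2)` on `ℝ^d`,
where `x² = x₁² + ⋯ + x_d²`. -/
def rho {d : ℕ} (x : Fin d → ℝ) : ℝ :=
  (2 * Real.pi) ^ (-(d : ℝ) / 2) * Real.exp (-(∑ j, x j ^ 2) / 2)

/-- The entire continuation of the standard Gaussian density to `ℂ^d`;
here `z² = z₁² + ⋯ + z_d²`, without complex conjugation. -/
def rhoC {d : ℕ} (z : Fin d → ℂ) : ℂ :=
  (((2 * Real.pi) ^ (-(d : ℝ) / 2) : ℝ) : ℂ) * Complex.exp (-(∑ j, z j ^ 2) / 2)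

/-- The continuation agrees with the density on `ℝ^d`. -/
theorem rhoC_ofReal {d : ℕ} (x : Fin d → ℝ) :
    rhoC (fun j => (x j : ℂ)) = ((rho x : ℝ) : ℂ) := by
  simp [rhoC, rho]

/-- The Gaussian measure `ρ(x) dx` on `ℝ^d`. -/
def gaussianMeasure (d : ℕ) : Measure (Fin d → ℝ) :=
  volume.withDensity (fun x => ENNReal.ofReal (rho x))

/-- The Segal-Bargmann transform `Sf(z) = ∫ ρ(z - x) f(x) dx`, `z ∈ ℂ^d`. -/
def transform {d : ℕ} (f : (Fin d → ℝ) → ℂ) (z : Fin d → ℂ) : ℂ :=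
  ∫ x : Fin d → ℝ, rhoC (fun j => z j - (x j : ℂ)) * f x

/-- The point `x + iy` of `ℂ^d`. -/
def toComplex {d : ℕ} (x y : Fin d → ℝ) : Fin d → ℂ :=
  fun j => (x j : ℂ) + Complex.I * (y j : ℂ)

end SegalBargmann

end

/-!
Let `q` be the exponent conjugate to `p` and `a = q / 2`. For `G z = exp ((1 - a) z² / 2) F z` the
hypothesis on `F` says that `G` is integrable against the radial weight `exp (-a |w|² / 2)`, the
square root of the weight of a Bargmann–Fock space. An entire function with this property satisfies
the reproducing formula: translating `w` by `z` turns the integral into one of an entire function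
against a rotation invariant weight, which is evaluated by the mean value property on circles.

The transform of the coherent state at `w` is a Gaussian in `z` times the reproducing kernel, and
the `L^p(ρ)` norm of the coherent state times `exp (-a |w|² / 2)` does not depend on `w`, because
the integrand is merely translated when `w` moves; this is what forces `a = q / 2`. Hence
the superposition of coherent states with amplitude `G` lies in `L^p(ρ)` by Minkowski's inequality,
and by Fubini and the reproducing formula its transform is a multiple of `F`.

Uniqueness holds because on `iℝ^d` the transform of `f` is a Gaussian times the Fourier transform
of `ρ f`.
-/

noncomputable section

namespace SegalBargmann

open MeasureTheory Complex ComplexConjugate FourierTransform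
open scoped ENNReal

section FourierInjectivity

variable {E : Type*} [NormedAddCommGroup E] [NormedSpace ℂ E] [CompleteSpace E]

theorem ae_eq_of_fourier_eq {V : Type*} [NormedAddCommGroup V] [InnerProductSpace ℝ V]
    [FiniteDimensional ℝ V] [MeasurableSpace V] [BorelSpace V] {f g : V → E}
    (hf : Integrable f) (hg : Integrable g) (h : 𝓕 f = 𝓕 g) : f =ᵐ[volume] g := by
  refine ae_eq_of_integral_contDiff_smul_eq hf.locallyIntegrable hg.locallyIntegrable
    fun φ hφ hφc => ?_
  let ψ : SchwartzMap V ℂ := 𝓕⁻ ((hφc.comp_left (g := Complex.ofRealCLM) rfl).toSchwartzMap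
    (Complex.ofRealCLM.contDiff.comp hφ))
  have fourier_ψ (x : V) : 𝓕 (ψ : V → ℂ) x = φ x := by
    rw [← SchwartzMap.fourier_coe, FourierTransform.fourier_fourierInv_eq]
    rfl
  have pairing {k : V → E} (hk : Integrable k) : ∫ x, φ x • k x = ∫ ξ, ψ ξ • 𝓕 k ξ := by
    have := VectorFourier.integral_fourierIntegral_smul_eq_flip (L := innerₗ V)
      Real.continuous_fourierChar continuous_inner (ψ.integrable (μ := volume)) hk
    rw [flip_innerₗ] at this
    calc ∫ x, φ x • k x = ∫ x, 𝓕 (ψ : V → ℂ) x • k x := by simp only [fourier_ψ, coe_smul]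
      _ = ∫ ξ, ψ ξ • 𝓕 k ξ := this
  rw [pairing hf, pairing hg, h]

theorem ae_eq_of_integral_cexp_sum_mul_I_smul_eq {ι : Type*} [Fintype ι] {f g : (ι → ℝ) → E}
    (hf : Integrable f) (hg : Integrable g)
    (h : ∀ y : ι → ℝ, ∫ x : ι → ℝ, cexp (∑ j, y j * I * x j) • f x =
      ∫ x : ι → ℝ, cexp (∑ j, y j * I * x j) • g x) :
    f =ᵐ[volume] g := by
  have hpres := PiLp.volume_preserving_ofLp ι
  have hemb := (MeasurableEquiv.toLp 2 (ι → ℝ)).symm.measurableEmbedding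
  have fourier_eq (k : (ι → ℝ) → E) (v : EuclideanSpace ℝ ι) :
      𝓕 (k ∘ WithLp.ofLp : EuclideanSpace ℝ ι → E) v =
        ∫ x : ι → ℝ, cexp (∑ j, ((-(2 * Real.pi) * v j : ℝ) : ℂ) * I * x j) • k x := by
    rw [Real.fourier_eq', ← hpres.integral_comp hemb]
    refine integral_congr_ae (ae_of_all _ fun u => ?_)
    simp only [Function.comp_apply, PiLp.inner_apply, RCLike.inner_apply, conj_trivial]
    congr 2
    push_cast
    rw [Finset.mul_sum, Finset.sum_mul]
    exact Finset.sum_congr rfl fun j _ => by ring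
  exact (PiLp.volume_preserving_toLp ι).quasiMeasurePreserving.ae_eq_comp
    (ae_eq_of_fourier_eq ((hpres.integrable_comp_emb hemb).2 hf)
      ((hpres.integrable_comp_emb hemb).2 hg)
      (funext fun v => by rw [fourier_eq, fourier_eq, h]))

end FourierInjectivity

section Superposition

variable {X W : Type*} [MeasurableSpace X] [MeasurableSpace W]

theorem rpow_lintegral_le {ν : Measure W} {p : ℝ} (hp : 1 ≤ p)
    {φ : W → ℝ≥0∞} (hφ : AEMeasurable φ ν) :
    (∫⁻ w, φ w ∂ν) ^ p ≤ (∫⁻ w, φ w ^ p ∂ν) * ν Set.univ ^ (p - 1) := by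
  have hp0 : 0 < p := by linarith
  have holder := eLpNorm'_le_eLpNorm'_mul_rpow_measure_univ one_pos hp hφ.aestronglyMeasurable
  simp only [eLpNorm', ENNReal.rpow_one, div_one, enorm_eq_self] at holder
  refine (ENNReal.rpow_le_rpow holder hp0.le).trans_eq ?_
  rw [ENNReal.mul_rpow_of_nonneg _ _ hp0.le, ← ENNReal.rpow_mul, ← ENNReal.rpow_mul,
    one_div_mul_cancel hp0.ne', ENNReal.rpow_one, sub_mul, one_mul, one_div_mul_cancel hp0.ne']

theorem lintegral_rpow_lintegral_le {γ : Measure X} {ν : Measure W} [SFinite γ] [SFinite ν]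
    {p : ℝ} (hp : 1 ≤ p) {φ : X → W → ℝ≥0∞} (hφ : AEMeasurable (Function.uncurry φ) (γ.prod ν)) :
    ∫⁻ x, (∫⁻ w, φ x w ∂ν) ^ p ∂γ ≤
      (∫⁻ w, ∫⁻ x, φ x w ^ p ∂γ ∂ν) * ν Set.univ ^ (p - 1) := by
  have hsections : ∀ᵐ x ∂γ, AEMeasurable (φ x) ν :=
    (hφ.aestronglyMeasurable.prodMk_left).mono fun x hx => hx.aemeasurable
  have hφp := hφ.pow_const p
  calc ∫⁻ x, (∫⁻ w, φ x w ∂ν) ^ p ∂γ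
      ≤ ∫⁻ x, (∫⁻ w, φ x w ^ p ∂ν) * ν Set.univ ^ (p - 1) ∂γ :=
        lintegral_mono_ae (hsections.mono fun x hx => rpow_lintegral_le hp hx)
    _ = (∫⁻ x, ∫⁻ w, φ x w ^ p ∂ν ∂γ) * ν Set.univ ^ (p - 1) :=
        lintegral_mul_const'' _ hφp.lintegral_prod_right'
    _ = (∫⁻ w, ∫⁻ x, φ x w ^ p ∂γ ∂ν) * ν Set.univ ^ (p - 1) := by
        rw [lintegral_lintegral_swap hφp]

theorem memLp_integral_smul {𝕜 E : Type*} [NormedField 𝕜] [NormedAddCommGroup E]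
    [NormedSpace 𝕜 E] [NormedSpace ℝ E] {γ : Measure X} {μ : Measure W} [SFinite γ] [SFinite μ]
    {p : ℝ} (hp : 1 ≤ p) {k : X → W → E}
    (hk : AEStronglyMeasurable (Function.uncurry k) (γ.prod μ))
    {g : W → 𝕜} (hg : Integrable g μ) {C : ℝ≥0∞} (hC : C ≠ ∞)
    (hkC : ∀ᵐ w ∂μ, ∫⁻ x, ‖k x w‖ₑ ^ p ∂γ ≤ C) :
    MemLp (fun x => ∫ w, g w • k x w ∂μ) (ENNReal.ofReal p) γ := by
  have hp0 : 0 < p := by linarith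
  refine ⟨(hg.aestronglyMeasurable.comp_snd.smul hk).integral_prod_right', ?_⟩
  rw [eLpNorm_lt_top_iff_lintegral_rpow_enorm_lt_top (by simpa using hp0) ENNReal.ofReal_ne_top,
    ENNReal.toReal_ofReal hp0.le]
  set ν := μ.withDensity fun w => ‖g w‖ₑ
  have hν_univ : ν Set.univ < ∞ := by
    rw [withDensity_apply _ .univ, Measure.restrict_univ]
    exact hg.2
  have hν_ac : ν ≪ μ := withDensity_absolutelyContinuous _ _
  have norm_le : ∀ᵐ x ∂γ, ‖∫ w, g w • k x w ∂μ‖ₑ ≤ ∫⁻ w, ‖k x w‖ₑ ∂ν := by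
    filter_upwards [hk.prodMk_left] with x hx
    refine (enorm_integral_le_lintegral_enorm _).trans_eq ?_
    simp only [ν, enorm_smul]
    exact (lintegral_withDensity_eq_lintegral_mul₀ hg.1.enorm hx.enorm).symm
  calc ∫⁻ x, ‖∫ w, g w • k x w ∂μ‖ₑ ^ p ∂γ
      ≤ ∫⁻ x, (∫⁻ w, ‖k x w‖ₑ ∂ν) ^ p ∂γ :=
        lintegral_mono_ae (norm_le.mono fun x hx => ENNReal.rpow_le_rpow hx hp0.le)
    _ ≤ (∫⁻ w, ∫⁻ x, ‖k x w‖ₑ ^ p ∂γ ∂ν) * ν Set.univ ^ (p - 1) :=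
        lintegral_rpow_lintegral_le hp (hk.mono_ac (.prod .rfl hν_ac)).enorm
    _ ≤ (∫⁻ _, C ∂ν) * ν Set.univ ^ (p - 1) := by
        gcongr ?_ * _
        exact lintegral_mono_ae (hν_ac.ae_le hkC)
    _ < ∞ := by
        rw [lintegral_const]
        exact ENNReal.mul_lt_top (ENNReal.mul_lt_top hC.lt_top hν_univ)
          (ENNReal.rpow_lt_top_of_nonneg (by linarith) hν_univ.ne)

end Superposition

section CircleInvariance

variable {V E : Type*} [NormedAddCommGroup V] [NormedSpace ℂ V] [NormedAddCommGroup E]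
  [NormedSpace ℂ E] [CompleteSpace E]

theorem intervalIntegral_comp_circleExp_smul {H : V → E} (hH : Differentiable ℂ H) (v : V) :
    ∫ θ in (0 : ℝ)..2 * Real.pi, H (Circle.exp θ • v) = (2 * Real.pi) • H 0 := by
  have hline : Differentiable ℂ fun t : ℂ => H (t • v) := by fun_prop
  have mean := (hline.diffContOnCl (s := Metric.ball 0 |1|)).circleAverage
  rw [Real.circleAverage_def, inv_smul_eq_iff₀ (by positivity), zero_smul] at mean
  simpa [circleMap, Circle.smul_def] using mean

variable [MeasurableSpace V] [BorelSpace V] {μ : Measure V} [SFinite μ]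
  [SMulInvariantMeasure Circle V μ]

theorem measurePreserving_prodMk_circleExp_smul (ν : Measure ℝ) [SFinite ν] :
    MeasurePreserving (fun q : ℝ × V => (q.1, Circle.exp q.1 • q.2)) (ν.prod μ) (ν.prod μ) :=
  (MeasurePreserving.id ν).skew_product (g := fun θ v => Circle.exp θ • v)
    (Continuous.measurable (by fun_prop))
    (ae_of_all _ fun θ => (measurePreserving_smul (Circle.exp θ) μ).map_eq)

theorem integral_smul_eq_of_circle_invariant {H : V → E} (hH : Differentiable ℂ H) {g : V → ℂ}
    (hg : ∀ (c : Circle) (v : V), g (c • v) = g v) (hint : Integrable (fun v => g v • H v) μ) :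
    ∫ v, g v • H v ∂μ = (∫ v, g v ∂μ) • H 0 := by
  have rotate (θ : ℝ) : ∫ v, g v • H (Circle.exp θ • v) ∂μ = ∫ v, g v • H v ∂μ := by
    simpa only [hg] using integral_smul_eq_self (μ := μ) (fun v => g v • H v) (g := Circle.exp θ)
  have hprod : Integrable (fun q : ℝ × V => g q.2 • H (Circle.exp q.1 • q.2))
      ((volume.restrict (Set.uIoc 0 (2 * Real.pi))).prod μ) := by
    have : IsFiniteMeasure (volume.restrict (Set.uIoc 0 (2 * Real.pi))) := by
      rw [Set.uIoc]; infer_instance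
    simpa only [Function.comp_def, hg] using
      (measurePreserving_prodMk_circleExp_smul _).integrable_comp_of_integrable (hint.comp_snd _)
  have h2π : 2 * Real.pi ≠ 0 := by positivity
  refine (smul_right_inj h2π).1 ?_
  calc (2 * Real.pi) • ∫ v, g v • H v ∂μ
      = ∫ θ in (0 : ℝ)..2 * Real.pi, ∫ v, g v • H (Circle.exp θ • v) ∂μ := by
        simp only [rotate, intervalIntegral.integral_const, sub_zero]
    _ = ∫ v, (∫ θ in (0 : ℝ)..2 * Real.pi, g v • H (Circle.exp θ • v)) ∂μ :=
        intervalIntegral_integral_swap hprod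
    _ = ∫ v, g v • (2 * Real.pi) • H 0 ∂μ := by
        simp only [intervalIntegral.integral_smul, intervalIntegral_comp_circleExp_smul hH]
    _ = (2 * Real.pi) • (∫ v, g v ∂μ) • H 0 := by
        rw [integral_smul_const, smul_comm]

end CircleInvariance

instance smulInvariantMeasure_circle_pi {ι : Type*} [Fintype ι] :
    SMulInvariantMeasure Circle (ι → ℂ) volume :=
  ((smulInvariantMeasure_tfae Circle volume).out 0 6).2 fun c =>
    volume_preserving_pi fun _ => (rotation c).measurePreserving

section FockSpace

variable {ι : Type*} [Fintype ι]

/-- The Gaussian weight `exp (-a |w|²)` of the Bargmann–Fock space on `ℂ^ι`, not normalized. -/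
def fockWeight (a : ℝ) (w : ι → ℂ) : ℝ :=
  Real.exp (-a * ∑ j, ‖w j‖ ^ 2)

/-- The reproducing kernel `exp (a z·w̄)` of the Bargmann–Fock space with weight `fockWeight a`,
up to the normalization of the weight. -/
def fockKernel (a : ℝ) (z w : ι → ℂ) : ℂ :=
  cexp (a * ∑ j, z j * conj (w j))

theorem sum_sq_norm (w : ι → ℂ) : ∑ j, ‖w j‖ ^ 2 = ∑ j, (w j).re ^ 2 + ∑ j, (w j).im ^ 2 := by
  simp only [Complex.sq_norm, normSq_apply, ← pow_two, Finset.sum_add_distrib]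

theorem re_sum_sq (w : ι → ℂ) : (∑ j, w j ^ 2).re = ∑ j, (w j).re ^ 2 - ∑ j, (w j).im ^ 2 := by
  simp only [re_sum, pow_two, mul_re, Finset.sum_sub_distrib]

@[fun_prop]
theorem continuous_fockWeight (a : ℝ) : Continuous (fockWeight a : (ι → ℂ) → ℝ) := by
  unfold fockWeight; fun_prop

@[fun_prop]
theorem continuous_fockKernel (a : ℝ) (z : ι → ℂ) : Continuous (fockKernel a z) := by
  unfold fockKernel; fun_prop

theorem fockWeight_pos (a : ℝ) (w : ι → ℂ) : 0 < fockWeight a w := Real.exp_pos _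

theorem fockWeight_half_mul_self (a : ℝ) (w : ι → ℂ) :
    fockWeight (a / 2) w * fockWeight (a / 2) w = fockWeight a w := by
  rw [fockWeight, fockWeight, ← Real.exp_add]; congr 1; ring

theorem fockWeight_circle_smul (a : ℝ) (c : Circle) (w : ι → ℂ) :
    fockWeight a (c • w) = fockWeight a w := by
  simp only [fockWeight, Pi.smul_apply, norm_smul, Circle.smul_def, Circle.norm_coe, one_mul]

theorem integral_fockWeight {a : ℝ} (ha : 0 < a) :
    ∫ w : ι → ℂ, fockWeight a w = (Real.pi / a) ^ Fintype.card ι := by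
  have one_variable : ∫ z : ℂ, Real.exp (-a * ‖z‖ ^ 2) = Real.pi / a := by
    rw [GaussianFourier.integral_rexp_neg_mul_sq_norm ha]; simp
  simp only [fockWeight, Finset.mul_sum, Real.exp_sum]
  rw [integral_fintype_prod_volume_eq_pow (fun z : ℂ => Real.exp (-a * ‖z‖ ^ 2)), one_variable]

theorem fockKernel_mul_fockWeight (a : ℝ) (z w : ι → ℂ) :
    fockKernel a z w * fockWeight a w =
      fockWeight a (w - z) * cexp (-a * ∑ j, conj (z j) * (w - z) j) := by
  rw [fockKernel, fockWeight, fockWeight, ofReal_exp, ofReal_exp, ← exp_add, ← exp_add]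
  congr 1
  push_cast
  simp only [Pi.sub_apply, ← conj_mul', Finset.mul_sum, ← Finset.sum_add_distrib, map_sub]
  exact Finset.sum_congr rfl fun j _ => by ring

theorem norm_fockKernel_mul_fockWeight_half_le {a : ℝ} (ha : 0 ≤ a) (z w : ι → ℂ) :
    ‖fockKernel a z w‖ * fockWeight (a / 2) w ≤ Real.exp (a / 2 * ∑ j, ‖z j‖ ^ 2) := by
  rw [fockKernel, norm_exp, fockWeight, ← Real.exp_add, Real.exp_le_exp]
  simp only [re_ofReal_mul, re_sum, Finset.mul_sum, ← Finset.sum_add_distrib]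
  refine Finset.sum_le_sum fun j _ => ?_
  have complete_square : 0 ≤ a / 2 * ‖z j - w j‖ ^ 2 := by positivity
  simp only [← normSq_eq_norm_sq, normSq_apply, mul_re, conj_re, conj_im, sub_re, sub_im]
    at complete_square ⊢
  linarith

variable {E : Type*} [NormedAddCommGroup E] [NormedSpace ℂ E] {G : (ι → ℂ) → E}

theorem integrable_fockKernel_mul_fockWeight_smul {a : ℝ} (ha : 0 ≤ a)
    (hint : Integrable fun w => (fockWeight (a / 2) w : ℂ) • G w) (z : ι → ℂ) :
    Integrable fun w => (fockKernel a z w * fockWeight a w) • G w := by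
  have bounded (w : ι → ℂ) : ‖fockKernel a z w * fockWeight (a / 2) w‖ ≤
      Real.exp (a / 2 * ∑ j, ‖z j‖ ^ 2) := by
    rw [norm_mul, norm_real, Real.norm_of_nonneg (fockWeight_pos _ _).le]
    exact norm_fockKernel_mul_fockWeight_half_le ha z w
  refine (hint.bdd_smul _ (Continuous.aestronglyMeasurable (by fun_prop))
    (ae_of_all _ bounded)).congr (ae_of_all _ fun w => ?_)
  simp only [Pi.smul_apply', smul_smul, mul_assoc, ← ofReal_mul, fockWeight_half_mul_self]

theorem reproducing_formula [CompleteSpace E] {a : ℝ} (ha : 0 < a) (hG : Differentiable ℂ G)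
    (hint : Integrable fun w => (fockWeight (a / 2) w : ℂ) • G w) (z : ι → ℂ) :
    ∫ w, (fockKernel a z w * fockWeight a w) • G w =
      ((Real.pi / a : ℝ) : ℂ) ^ Fintype.card ι • G z := by
  let H (u : ι → ℂ) : E := cexp (-a * ∑ j, conj (z j) * u j) • G (u + z)
  have hH : Differentiable ℂ H := by fun_prop
  have translate : (fun w => (fockKernel a z w * fockWeight a w) • G w) =
      fun w => (fun u => (fockWeight a u : ℂ) • H u) (w - z) := by
    funext w
    simp only [H, sub_add_cancel, smul_smul, fockKernel_mul_fockWeight]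
  have hH_int : Integrable fun u => (fockWeight a u : ℂ) • H u := by
    have := integrable_fockKernel_mul_fockWeight_smul ha.le hint z
    rw [translate] at this
    simpa using this.comp_add_right z
  calc ∫ w, (fockKernel a z w * fockWeight a w) • G w
      = ∫ u, (fockWeight a u : ℂ) • H u := by
        rw [translate, integral_sub_right_eq_self (fun u => (fockWeight a u : ℂ) • H u) z]
    _ = (∫ u : ι → ℂ, (fockWeight a u : ℂ)) • H 0 :=
        integral_smul_eq_of_circle_invariant hH
          (fun c w => by rw [fockWeight_circle_smul]) hH_int
    _ = ((Real.pi / a : ℝ) : ℂ) ^ Fintype.card ι • G z := by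
        rw [integral_complex_ofReal, integral_fockWeight ha]
        simp [H]

end FockSpace

section GaussianMeasure

theorem integrable_exp_neg_mul_sum_sq_add {ι : Type*} [Fintype ι] {b : ℝ} (hb : 0 < b)
    (c : ι → ℝ) :
    Integrable fun x : ι → ℝ => Real.exp (-b * ∑ j, x j ^ 2 + ∑ j, c j * x j) := by
  refine (GaussianFourier.integrable_cexp_neg_mul_sum_add (b := b) (by simpa using hb)
    (fun j => (c j : ℂ))).norm.congr (ae_of_all _ fun x => ?_)
  simp only [norm_exp]
  norm_cast

variable {d : ℕ}

theorem continuous_rho : Continuous (rho : (Fin d → ℝ) → ℝ) := by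
  unfold rho; fun_prop

@[fun_prop]
theorem continuous_rhoC : Continuous (rhoC : (Fin d → ℂ) → ℂ) := by
  unfold rhoC; fun_prop

theorem rho_pos (x : Fin d → ℝ) : 0 < rho x := by
  unfold rho; positivity

theorem integrable_rho : Integrable (rho : (Fin d → ℝ) → ℝ) := by
  refine ((integrable_exp_neg_mul_sum_sq_add one_half_pos 0).const_mul
    ((2 * Real.pi) ^ (-(d : ℝ) / 2))).congr (ae_of_all _ fun x => ?_)
  simp only [rho, Pi.zero_apply, zero_mul, Finset.sum_const_zero, add_zero]
  ring_nf

theorem rhoC_sub_ofReal_eq (z : Fin d → ℂ) (x : Fin d → ℝ) :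
    rhoC (fun j => z j - x j) = cexp (-(∑ j, z j ^ 2) / 2) * (cexp (∑ j, z j * x j) * rho x) := by
  simp only [rhoC, rho, ofReal_mul, ofReal_exp]
  rw [mul_left_comm (cexp (∑ j, z j * x j)), mul_left_comm, ← exp_add, ← exp_add]
  congr 2
  push_cast
  simp only [Finset.sum_div, ← Finset.sum_neg_distrib, ← Finset.sum_add_distrib]
  exact Finset.sum_congr rfl fun j _ => by ring

instance isFiniteMeasure_gaussianMeasure : IsFiniteMeasure (gaussianMeasure d) :=
  isFiniteMeasure_withDensity_ofReal integrable_rho.2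

theorem measurable_ofReal_rho : Measurable fun x : Fin d → ℝ => ENNReal.ofReal (rho x) :=
  continuous_rho.measurable.ennreal_ofReal

theorem gaussianMeasure_absolutelyContinuous : gaussianMeasure d ≪ volume :=
  withDensity_absolutelyContinuous _ _

theorem absolutelyContinuous_gaussianMeasure : volume ≪ gaussianMeasure d :=
  withDensity_absolutelyContinuous' measurable_ofReal_rho.aemeasurable
    (ae_of_all _ fun x => by simpa using rho_pos x)

theorem integrable_gaussianMeasure_iff {f : (Fin d → ℝ) → ℂ} :
    Integrable f (gaussianMeasure d) ↔ Integrable fun x => rho x * f x := by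
  rw [gaussianMeasure, integrable_withDensity_iff_integrable_smul₀'
    measurable_ofReal_rho.aemeasurable (ae_of_all _ fun x => ENNReal.ofReal_lt_top)]
  simp only [ENNReal.toReal_ofReal (rho_pos _).le, real_smul]

end GaussianMeasure

section Transform

variable {d : ℕ}

theorem transform_congr_ae {f g : (Fin d → ℝ) → ℂ} (h : f =ᵐ[gaussianMeasure d] g) :
    transform f = transform g := by
  funext z
  refine integral_congr_ae ?_
  filter_upwards [absolutelyContinuous_gaussianMeasure.ae_le h] with x hx
  rw [hx]

theorem transform_const_mul (c : ℂ) (f : (Fin d → ℝ) → ℂ) (z : Fin d → ℂ) :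
    transform (fun x => c * f x) z = c * transform f z := by
  simp only [transform, mul_left_comm _ c, integral_const_mul]

theorem transform_eq_cexp_mul_integral (f : (Fin d → ℝ) → ℂ) (z : Fin d → ℂ) :
    transform f z =
      cexp (-(∑ j, z j ^ 2) / 2) * ∫ x : Fin d → ℝ, cexp (∑ j, z j * x j) * (rho x * f x) := by
  simp only [transform, rhoC_sub_ofReal_eq, mul_assoc, integral_const_mul]

theorem ae_eq_of_transform_eq {f g : (Fin d → ℝ) → ℂ} (hf : Integrable f (gaussianMeasure d))
    (hg : Integrable g (gaussianMeasure d)) (h : transform f = transform g) :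
    f =ᵐ[gaussianMeasure d] g := by
  have weighted_eq : (fun x => rho x * f x) =ᵐ[volume] fun x => rho x * g x := by
    refine ae_eq_of_integral_cexp_sum_mul_I_smul_eq (integrable_gaussianMeasure_iff.1 hf)
      (integrable_gaussianMeasure_iff.1 hg) fun y => ?_
    have at_imaginary := congrFun h fun j => y j * I
    simp only [transform_eq_cexp_mul_integral] at at_imaginary
    exact mul_left_cancel₀ (exp_ne_zero _) at_imaginary
  filter_upwards [gaussianMeasure_absolutelyContinuous.ae_le weighted_eq] with x hx
  exact mul_left_cancel₀ (ofReal_ne_zero.2 (rho_pos x).ne') hx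

end Transform

section CoherentState

variable {d : ℕ}

/-- The coherent state of `ℝ^d` attached to `w ∈ ℂ^d`: the Gaussian wave packet whose
Segal–Bargmann transform is, up to a Gaussian factor, the reproducing kernel `fockKernel a · w`. -/
def coherent (a : ℝ) (w : Fin d → ℂ) (x : Fin d → ℝ) : ℂ :=
  cexp (-((a⁻¹ - 1) / 2) * ∑ j, (x j : ℂ) ^ 2 + ∑ j, conj (w j) * x j -
    a / 2 * ∑ j, conj (w j) ^ 2)

theorem continuous_uncurry_coherent (a : ℝ) :
    Continuous fun q : (Fin d → ℝ) × (Fin d → ℂ) => coherent a q.2 q.1 := by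
  unfold coherent; fun_prop

theorem cexp_mul_rho_mul_coherent (a : ℝ) (z w : Fin d → ℂ) (x : Fin d → ℝ) :
    cexp (∑ j, z j * x j) * (rho x * coherent a w x) =
      ((2 * Real.pi) ^ (-(d : ℝ) / 2) : ℝ) * cexp (-(a / 2 * ∑ j, conj (w j) ^ 2)) *
        cexp (-((2 * a)⁻¹ : ℝ) * ∑ j, (x j : ℂ) ^ 2 + ∑ j, (z j + conj (w j)) * x j) := by
  rw [rho, coherent, ofReal_mul, ofReal_exp, mul_assoc, mul_left_comm, mul_assoc]
  simp only [← exp_add]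
  congr 2
  simp only [add_mul, Finset.sum_add_distrib]
  push_cast
  rw [mul_inv]
  ring

theorem transform_coherent {a : ℝ} (ha : 0 < a) (z w : Fin d → ℂ) :
    transform (coherent a w) z = (a ^ ((d : ℝ) / 2) : ℝ) *
      (cexp (-((1 - a) / 2 * ∑ j, z j ^ 2)) * fockKernel a z w) := by
  have constant : (2 * Real.pi) ^ (-(d : ℝ) / 2) * (Real.pi / (2 * a)⁻¹) ^ ((d : ℝ) / 2) =
      a ^ ((d : ℝ) / 2) := by
    rw [div_inv_eq_mul, show Real.pi * (2 * a) = 2 * Real.pi * a by ring,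
      Real.mul_rpow (by positivity) ha.le, ← mul_assoc, ← Real.rpow_add (by positivity)]
    simp [neg_div]
  have gaussian := GaussianFourier.integral_cexp_neg_mul_sum_add (b := ((2 * a)⁻¹ : ℝ))
    (by simpa using ha) fun j => z j + conj (w j)
  have exponent : -(∑ j, z j ^ 2) / 2 - a / 2 * ∑ j, conj (w j) ^ 2 +
      (∑ j, (z j + conj (w j)) ^ 2) / (4 * ((2 * a)⁻¹ : ℝ)) =
      -((1 - a) / 2 * ∑ j, z j ^ 2) + a * ∑ j, z j * conj (w j) := by
    simp only [add_sq, Finset.sum_add_distrib, mul_assoc, ← Finset.mul_sum]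
    push_cast
    field_simp
    ring
  rw [transform_eq_cexp_mul_integral]
  simp only [cexp_mul_rho_mul_coherent]
  rw [integral_const_mul, gaussian, fockKernel, ← exp_add, ← exponent, exp_add, sub_eq_add_neg,
    exp_add, ← constant, ofReal_mul, ofReal_cpow (x := Real.pi / (2 * a)⁻¹) (by positivity)]
  push_cast
  rw [Fintype.card_fin]
  ring

theorem fockWeight_half_mul_norm_coherent (a : ℝ) (w : Fin d → ℂ) (x : Fin d → ℝ) :
    fockWeight (a / 2) w * ‖coherent a w x‖ =
      Real.exp (-((a⁻¹ - 1) / 2) * ∑ j, x j ^ 2 + ∑ j, (w j).re * x j -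
        a * ∑ j, (w j).re ^ 2) := by
  have cast : -((a⁻¹ - 1) / 2) * ∑ j, (x j : ℂ) ^ 2 + ∑ j, conj (w j) * x j -
      a / 2 * ∑ j, conj (w j) ^ 2 = ((-((a⁻¹ - 1) / 2) * ∑ j, x j ^ 2 : ℝ) : ℂ) +
        ∑ j, conj (w j) * x j - ((a / 2 : ℝ) : ℂ) * conj (∑ j, w j ^ 2) := by
    simp only [map_sum, map_pow]; push_cast; rfl
  rw [coherent, norm_exp, fockWeight, ← Real.exp_add, cast, sub_re, add_re, ofReal_re,
    re_ofReal_mul, conj_re, re_sum_sq, sum_sq_norm, re_sum]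
  simp only [re_mul_ofReal, conj_re]
  ring_nf

theorem fockWeight_half_mul_norm_rho_mul_coherent_le {a : ℝ} (ha : 0 < a) (w : Fin d → ℂ)
    (x : Fin d → ℝ) :
    fockWeight (a / 2) w * ‖rho x * coherent a w x‖ ≤
      (2 * Real.pi) ^ (-(d : ℝ) / 2) * Real.exp (-(4 * a)⁻¹ * ∑ j, x j ^ 2) := by
  rw [norm_mul, mul_left_comm, fockWeight_half_mul_norm_coherent, norm_real,
    Real.norm_of_nonneg (rho_pos x).le, rho, mul_assoc, ← Real.exp_add]
  refine mul_le_mul_of_nonneg_left (Real.exp_le_exp.2 ?_) (by positivity)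
  have complete_square : 0 ≤ a * ∑ j, ((w j).re - (2 * a)⁻¹ * x j) ^ 2 := by positivity
  have expand : a * ∑ j, ((w j).re - (2 * a)⁻¹ * x j) ^ 2 =
      a * ∑ j, (w j).re ^ 2 - ∑ j, (w j).re * x j + (4 * a)⁻¹ * ∑ j, x j ^ 2 := by
    simp only [Finset.mul_sum, ← Finset.sum_sub_distrib, ← Finset.sum_add_distrib]
    refine Finset.sum_congr rfl fun j _ => ?_
    field_simp
    ring
  linear_combination complete_square + expand

theorem rho_mul_fockWeight_mul_norm_coherent_rpow {p q : ℝ} (hpq : p.HolderConjugate q)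
    (w : Fin d → ℂ) (x : Fin d → ℝ) :
    rho x * (fockWeight (q / 2 / 2) w * ‖coherent (q / 2) w x‖) ^ p =
      (2 * Real.pi) ^ (-(d : ℝ) / 2) *
        Real.exp (-((p - 1) / 2) * ∑ j, (x j - q * (w j).re) ^ 2) := by
  rw [fockWeight_half_mul_norm_coherent, rho, mul_assoc, ← Real.exp_mul, ← Real.exp_add]
  congr 2
  have expand : ∑ j, (x j - q * (w j).re) ^ 2 =
      ∑ j, x j ^ 2 - 2 * q * ∑ j, (w j).re * x j + q ^ 2 * ∑ j, (w j).re ^ 2 := by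
    simp only [Finset.mul_sum, ← Finset.sum_sub_distrib, ← Finset.sum_add_distrib]
    exact Finset.sum_congr rfl fun j _ => by ring
  have hp := hpq.pos.ne'
  have hp1 := hpq.sub_one_pos.ne'
  rw [expand, hpq.conjugate_eq]
  field_simp
  ring

end CoherentState

section Synthesis

variable {d : ℕ}

/-- The superposition of the coherent states `coherent a w` with amplitude `G` on phase space,
against the weight of the Bargmann–Fock space. -/
def synthesis (a : ℝ) (G : (Fin d → ℂ) → ℂ) (x : Fin d → ℝ) : ℂ :=
  ∫ w, coherent a w x * (fockWeight a w * G w)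

theorem lintegral_enorm_fockWeight_mul_coherent_rpow {p q : ℝ} (hpq : p.HolderConjugate q)
    (w : Fin d → ℂ) :
    ∫⁻ x, ‖fockWeight (q / 2 / 2) w * coherent (q / 2) w x‖ₑ ^ p ∂gaussianMeasure d =
      ∫⁻ x : Fin d → ℝ, ENNReal.ofReal
        ((2 * Real.pi) ^ (-(d : ℝ) / 2) * Real.exp (-((p - 1) / 2) * ∑ j, x j ^ 2)) := by
  have hcont : Continuous (coherent (q / 2) w) := by unfold coherent; fun_prop
  have integrand (x : Fin d → ℝ) : ENNReal.ofReal (rho x) *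
      ‖fockWeight (q / 2 / 2) w * coherent (q / 2) w x‖ₑ ^ p =
      ENNReal.ofReal ((2 * Real.pi) ^ (-(d : ℝ) / 2) *
        Real.exp (-((p - 1) / 2) * ∑ j, (x j - q * (w j).re) ^ 2)) := by
    rw [← ofReal_norm, norm_mul, norm_real, Real.norm_of_nonneg (fockWeight_pos _ _).le,
      ENNReal.ofReal_rpow_of_nonneg (mul_nonneg (fockWeight_pos _ _).le (norm_nonneg _))
        hpq.nonneg,
      ← ENNReal.ofReal_mul (rho_pos x).le, rho_mul_fockWeight_mul_norm_coherent_rpow hpq]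
  rw [gaussianMeasure, lintegral_withDensity_eq_lintegral_mul _ measurable_ofReal_rho
    (by fun_prop)]
  simp only [Pi.mul_apply, integrand]
  exact lintegral_sub_right_eq_self (μ := volume) (fun x : Fin d → ℝ => ENNReal.ofReal
    ((2 * Real.pi) ^ (-(d : ℝ) / 2) * Real.exp (-((p - 1) / 2) * ∑ j, x j ^ 2)))
    fun j => q * (w j).re

theorem memLp_synthesis {p q : ℝ} (hpq : p.HolderConjugate q) {G : (Fin d → ℂ) → ℂ}
    (hint : Integrable fun w => (fockWeight (q / 2 / 2) w : ℂ) • G w) :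
    MemLp (synthesis (q / 2) G) (ENNReal.ofReal p) (gaussianMeasure d) := by
  have gaussian_integrable : Integrable fun x : Fin d → ℝ =>
      (2 * Real.pi) ^ (-(d : ℝ) / 2) * Real.exp (-((p - 1) / 2) * ∑ j, x j ^ 2) := by
    simpa using (integrable_exp_neg_mul_sum_sq_add (half_pos hpq.sub_one_pos) 0).const_mul _
  have hcoh := continuous_uncurry_coherent (d := d) (q / 2)
  have hkernel : Continuous (Function.uncurry fun (x : Fin d → ℝ) (w : Fin d → ℂ) =>
      fockWeight (q / 2 / 2) w * coherent (q / 2) w x) := by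
    simp only [Function.uncurry_def]; fun_prop
  have split_weight : synthesis (q / 2) G = fun x => ∫ w,
      ((fockWeight (q / 2 / 2) w : ℂ) • G w) •
        (fockWeight (q / 2 / 2) w * coherent (q / 2) w x) := by
    funext x
    refine integral_congr_ae (ae_of_all _ fun w => ?_)
    simp only [← fockWeight_half_mul_self (q / 2), ofReal_mul, smul_eq_mul]
    ring
  rw [split_weight]
  exact memLp_integral_smul hpq.lt.le hkernel.aestronglyMeasurable hint
    gaussian_integrable.lintegral_lt_top.ne
    (ae_of_all _ fun w => (lintegral_enorm_fockWeight_mul_coherent_rpow hpq w).le)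

theorem norm_rhoC_sub_mul_fockWeight_mul_coherent_le {a : ℝ} (ha : 0 < a) (z w : Fin d → ℂ)
    (x : Fin d → ℝ) :
    ‖rhoC (fun j => z j - x j) * (fockWeight (a / 2) w * coherent a w x)‖ ≤
      ‖cexp (-(∑ j, z j ^ 2) / 2)‖ * (2 * Real.pi) ^ (-(d : ℝ) / 2) *
        Real.exp (-(4 * a)⁻¹ * ∑ j, x j ^ 2 + ∑ j, (z j).re * x j) := by
  have norm_cexp : ‖cexp (∑ j, z j * x j)‖ = Real.exp (∑ j, (z j).re * x j) := by
    simp only [norm_exp, re_sum, re_mul_ofReal]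
  calc ‖rhoC (fun j => z j - x j) * (fockWeight (a / 2) w * coherent a w x)‖
      = ‖cexp (-(∑ j, z j ^ 2) / 2)‖ * Real.exp (∑ j, (z j).re * x j) *
          (fockWeight (a / 2) w * ‖rho x * coherent a w x‖) := by
        rw [rhoC_sub_ofReal_eq]
        simp only [norm_mul, norm_cexp, norm_real,
          Real.norm_of_nonneg (fockWeight_pos (a / 2) w).le]
        ring
    _ ≤ ‖cexp (-(∑ j, z j ^ 2) / 2)‖ * Real.exp (∑ j, (z j).re * x j) *
          ((2 * Real.pi) ^ (-(d : ℝ) / 2) * Real.exp (-(4 * a)⁻¹ * ∑ j, x j ^ 2)) :=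
        mul_le_mul_of_nonneg_left (fockWeight_half_mul_norm_rho_mul_coherent_le ha w x)
          (by positivity)
    _ = ‖cexp (-(∑ j, z j ^ 2) / 2)‖ * (2 * Real.pi) ^ (-(d : ℝ) / 2) *
          Real.exp (-(4 * a)⁻¹ * ∑ j, x j ^ 2 + ∑ j, (z j).re * x j) := by
        rw [Real.exp_add]; ring

theorem integrable_rhoC_sub_mul_coherent_mul {a : ℝ} (ha : 0 < a) {G : (Fin d → ℂ) → ℂ}
    (hint : Integrable fun w => (fockWeight (a / 2) w : ℂ) • G w) (z : Fin d → ℂ) :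
    Integrable (Function.uncurry fun (x : Fin d → ℝ) (w : Fin d → ℂ) =>
      rhoC (fun j => z j - x j) * (coherent a w x * (fockWeight a w * G w))) := by
  have split_weight : (Function.uncurry fun (x : Fin d → ℝ) (w : Fin d → ℂ) =>
      rhoC (fun j => z j - x j) * (coherent a w x * (fockWeight a w * G w))) = fun u =>
        rhoC (fun j => z j - u.1 j) * (fockWeight (a / 2) u.2 * coherent a u.2 u.1) *
          ((fockWeight (a / 2) u.2 : ℂ) • G u.2) := by
    funext u
    simp only [Function.uncurry, ← fockWeight_half_mul_self a, ofReal_mul, smul_eq_mul]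
    ring
  have hcoh := continuous_uncurry_coherent (d := d) a
  have hdominant := (integrable_exp_neg_mul_sum_sq_add (inv_pos.2 (mul_pos four_pos ha))
    fun j => (z j).re).const_mul (‖cexp (-(∑ j, z j ^ 2) / 2)‖ * (2 * Real.pi) ^ (-(d : ℝ) / 2))
  rw [split_weight]
  refine (hdominant.mul_prod hint.norm).mono' ?_ (ae_of_all _ fun u => ?_)
  · exact (Continuous.aestronglyMeasurable (by fun_prop)).mul hint.aestronglyMeasurable.comp_snd
  · rw [norm_mul]
    gcongr
    exact norm_rhoC_sub_mul_fockWeight_mul_coherent_le ha z u.2 u.1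

theorem transform_synthesis {a : ℝ} (ha : 0 < a) {G : (Fin d → ℂ) → ℂ}
    (hG : Differentiable ℂ G)
    (hint : Integrable fun w => (fockWeight (a / 2) w : ℂ) • G w) (z : Fin d → ℂ) :
    transform (synthesis a G) z = ((a ^ ((d : ℝ) / 2) * (Real.pi / a) ^ d : ℝ) : ℂ) *
      (cexp (-((1 - a) / 2 * ∑ j, z j ^ 2)) * G z) := by
  have integral_packet (w : Fin d → ℂ) :
      ∫ x : Fin d → ℝ, rhoC (fun j => z j - x j) * (coherent a w x * (fockWeight a w * G w)) =
        (a ^ ((d : ℝ) / 2) : ℝ) * cexp (-((1 - a) / 2 * ∑ j, z j ^ 2)) *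
          ((fockKernel a z w * fockWeight a w) • G w) := by
    have packet := transform_coherent ha z w
    rw [transform] at packet
    simp only [← mul_assoc, integral_mul_const, packet, smul_eq_mul]
  calc transform (synthesis a G) z
      = ∫ x : Fin d → ℝ, ∫ w, rhoC (fun j => z j - x j) *
          (coherent a w x * (fockWeight a w * G w)) := by
        simp only [transform, synthesis, integral_const_mul]
    _ = ∫ w, ∫ x : Fin d → ℝ, rhoC (fun j => z j - x j) *
          (coherent a w x * (fockWeight a w * G w)) :=
        integral_integral_swap (integrable_rhoC_sub_mul_coherent_mul ha hint z)
    _ = ((a ^ ((d : ℝ) / 2) * (Real.pi / a) ^ d : ℝ) : ℂ) *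
          (cexp (-((1 - a) / 2 * ∑ j, z j ^ 2)) * G z) := by
        simp only [integral_packet]
        rw [integral_const_mul, reproducing_formula ha hG hint, Fintype.card_fin, smul_eq_mul]
        push_cast
        ring

end Synthesis

section Surjectivity

variable {d : ℕ}

/-- The amplitude with which the coherent states of parameter `a` are superposed in order to
obtain a function with transform `F`: the Gaussian factor compensates the one in
`transform_coherent`. -/
def fockAmplitude (a : ℝ) (F : (Fin d → ℂ) → ℂ) (w : Fin d → ℂ) : ℂ :=
  cexp ((1 - a) / 2 * ∑ j, w j ^ 2) * F w

theorem fockWeight_mul_norm_fockAmplitude {p q : ℝ} (hpq : p.HolderConjugate q)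
    (F : (Fin d → ℂ) → ℂ) (w : Fin d → ℂ) :
    fockWeight (q / 2 / 2) w * ‖fockAmplitude (q / 2) F w‖ =
      ‖F w‖ * Real.exp (-(∑ j, (w j).im ^ 2) / 2) *
        Real.exp (-(∑ j, (w j).re ^ 2) / (2 * (p - 1))) := by
  have hp1 := hpq.sub_one_pos.ne'
  have cast : (1 - ((q / 2 : ℝ) : ℂ)) / 2 = (((1 - q / 2) / 2 : ℝ) : ℂ) := by push_cast; rfl
  rw [fockAmplitude, fockWeight, norm_mul, norm_exp, ← mul_assoc, ← Real.exp_add, mul_comm,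
    mul_assoc, ← Real.exp_add, cast, re_ofReal_mul, re_sum_sq, sum_sq_norm, hpq.conjugate_eq]
  congr 2
  field_simp
  ring

theorem measurePreserving_toComplex :
    MeasurePreserving (fun u : (Fin d → ℝ) × (Fin d → ℝ) => toComplex u.1 u.2) := by
  have regroup := (volume_measurePreserving_arrowProdEquivProdArrow ℝ ℝ (Fin d)).symm
  have componentwise := volume_preserving_pi
    fun _ : Fin d => Complex.volume_preserving_equiv_real_prod.symm
  have factor : (fun u : (Fin d → ℝ) × (Fin d → ℝ) => toComplex u.1 u.2) =
      (fun v j => measurableEquivRealProd.symm (v j)) ∘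
        (MeasurableEquiv.arrowProdEquivProdArrow ℝ ℝ (Fin d)).symm := by
    funext u j
    rw [toComplex, mul_comm]
    exact (mk_eq_add_mul_I (u.1 j) (u.2 j)).symm
  rw [factor]
  exact componentwise.comp regroup

theorem integrable_fockWeight_smul_fockAmplitude {p q : ℝ} (hpq : p.HolderConjugate q)
    {F : (Fin d → ℂ) → ℂ} (hF : Continuous F)
    (hint : Integrable fun u : (Fin d → ℝ) × (Fin d → ℝ) =>
      ‖F (toComplex u.1 u.2)‖ * Real.exp (-(∑ j, u.2 j ^ 2) / 2) *
        Real.exp (-(∑ j, u.1 j ^ 2) / (2 * (p - 1)))) :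
    Integrable fun w => (fockWeight (q / 2 / 2) w : ℂ) • fockAmplitude (q / 2) F w := by
  have hcont : Continuous fun w => (fockWeight (q / 2 / 2) w : ℂ) • fockAmplitude (q / 2) F w := by
    unfold fockAmplitude; fun_prop
  rw [← integrable_norm_iff hcont.aestronglyMeasurable,
    ← measurePreserving_toComplex.integrable_comp hcont.norm.aestronglyMeasurable]
  refine hint.congr (ae_of_all _ fun u => ?_)
  rw [Function.comp_apply, norm_smul, norm_real, Real.norm_of_nonneg (fockWeight_pos _ _).le,
    fockWeight_mul_norm_fockAmplitude hpq]
  simp [toComplex]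

theorem exists_memLp_transform_eq {p : ℝ} (hp : 1 < p) {F : (Fin d → ℂ) → ℂ}
    (hF : Differentiable ℂ F)
    (hint : Integrable fun u : (Fin d → ℝ) × (Fin d → ℝ) =>
      ‖F (toComplex u.1 u.2)‖ * Real.exp (-(∑ j, u.2 j ^ 2) / 2) *
        Real.exp (-(∑ j, u.1 j ^ 2) / (2 * (p - 1)))) :
    ∃ f : (Fin d → ℝ) → ℂ,
      MemLp f (ENNReal.ofReal p) (gaussianMeasure d) ∧ transform f = F := by
  have hpq := Real.HolderConjugate.conjExponent hp
  set a := p.conjExponent / 2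
  have ha : 0 < a := half_pos hpq.symm.pos
  have hG : Differentiable ℂ (fockAmplitude a F) := by unfold fockAmplitude; fun_prop
  have hG_int := integrable_fockWeight_smul_fockAmplitude hpq hF.continuous hint
  have hK : ((a ^ ((d : ℝ) / 2) * (Real.pi / a) ^ d : ℝ) : ℂ) ≠ 0 :=
    ofReal_ne_zero.2 (by positivity)
  refine ⟨fun x => ((a ^ ((d : ℝ) / 2) * (Real.pi / a) ^ d : ℝ) : ℂ)⁻¹ *
    synthesis a (fockAmplitude a F) x, (memLp_synthesis hpq hG_int).const_mul _, funext fun z => ?_⟩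
  rw [transform_const_mul, transform_synthesis ha hG hG_int, inv_mul_cancel_left₀ hK,
    fockAmplitude, ← mul_assoc, ← exp_add, neg_add_cancel, exp_zero, one_mul]

end Surjectivity

end SegalBargmann

end

theorem mainTheorem1 (d : ℕ) (p : ℝ) (hp : 1 < p)
    (F : (Fin d → ℂ) → ℂ) (hF : Differentiable ℂ F)
    (hint : MeasureTheory.Integrable
      (fun w : (Fin d → ℝ) × (Fin d → ℝ) =>
        ‖F (SegalBargmann.toComplex w.1 w.2)‖ * Real.exp (-(∑ j, w.2 j ^ 2) / 2) *
          Real.exp (-(∑ j, w.1 j ^ 2) / (2 * (p - 1))))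
      MeasureTheory.volume) :
    ∃! f : MeasureTheory.Lp ℂ (ENNReal.ofReal p) (SegalBargmann.gaussianMeasure d),
      SegalBargmann.transform (f : (Fin d → ℝ) → ℂ) = F := by
  have hp1 : (1 : ENNReal) ≤ ENNReal.ofReal p := ENNReal.one_le_ofReal.2 hp.le
  obtain ⟨f, hf, hfF⟩ := SegalBargmann.exists_memLp_transform_eq hp hF hint
  have transform_toLp : SegalBargmann.transform (hf.toLp f : (Fin d → ℝ) → ℂ) = F :=
    (SegalBargmann.transform_congr_ae hf.coeFn_toLp).trans hfF
  refine ⟨hf.toLp f, transform_toLp, fun g hg => ?_⟩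
  exact MeasureTheory.Lp.ext (SegalBargmann.ae_eq_of_transform_eq
    ((MeasureTheory.Lp.memLp g).integrable hp1)
    ((MeasureTheory.Lp.memLp (hf.toLp f)).integrable hp1) (hg.trans transform_toLp.symm))
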